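/- A monotone norm on $\mathbb{R}_+^n$ is a function $\|\cdot\|:\mathbb{R}_+^n\to\mathbb{R}_+$ that is subadditive, positively homogeneous, zero only at $0$, and satisfies $\|x\|\le\|y\|$ whenever $0\le x\le y$ coordinatewise; it is symmetric if it is invariant under permutations of the coordinates. Put $\sigma=\|(1,\dots,1)\|/\max_i\|e_i\|$ and $\rho=\|(1,\dots,1)\|/\min_i\|e_i\|$. In uniform-cost online facility location in a metric space $(M,d)$ with opening cost $f>0$ and norm $\|\cdot\|$, requests $x_1,\dots,x_n\in M$ arrive one by one. On the arrival of $x_i$ the algorithm, knowing only $x_1,\dots,x_i$ (and the metric space, $n$, $f$ and the norm), opens a facility at some point of $M$ or opens none; it must open one at time $1$. With $F_i$ the set of facilities opened up to and including time $i$, its cost is $f\,|F_n|+\|(d(x_i,F_i))_{i\le n}\|$. The offline optimum $\mathrm{OPT}(x)$ is the infimum of $f\,|F|+\|(d(x_i,F))_{i\le n}\|$ over nonempty finite $F\subseteq M$. A randomized online algorithm is a random choice of a deterministic one; it is $r$-competitive if its expected cost is at most $r\cdot\mathrm{OPT}(x)$ for every request sequence $x$. Theorem. There is an absolute constant $c>0$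 such that the following holds for every $n$ and every monotone norm on $\mathbb{R}_+^n$ with $\sigma\ge 4$. There are $k,N\ge 2$, an opening cost $f>0$ and a nondecreasing surjective map $\ell:\{1,\dots,n\}\to\{0,\dots,k\}$ such that, for the problem on the vertex set of the complete $N$-ary tree of height $k$, with the path metric in which every edge between depths $j$ and $j+1$ has length $k^{-j}$, every randomized online algorithm has the following two properties. 1. If it is $r$-competitive, then $r\ge c\,\dfrac{\log\sigma}{\log\log\sigma}$. 2. If $v_0v_1\cdots v_k$ is a uniformly random root-to-leaf path and the requests are $x_i=v_{\ell(i)}$, then its expected cost (over the path and its own randomness) is at least $c\,\dfrac{\log\sigma}{\log\log\sigma}\cdot\mathbb{E}[\mathrm{OPT}(x)]$. For a symmetric norm, $\sigma=\rho$, and the same holds with $\rho$ in place of $\sigma$: if $\rho\ge 4$, there is such a problem with lower bound $c\,\dfrac{\log\rho}{\log\log\rho}$. -/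

import Mathlib

open scoped NNReal ENNReal

/-- A monotone norm on the nonnegative orthant of `ℝⁿ`. -/
structure MonotoneNorm (n : ℕ) where
  toFun : (Fin n → ℝ≥0) → ℝ≥0
  add_le : ∀ x y, toFun (x + y) ≤ toFun x + toFun y
  smul_eq : ∀ (a : ℝ≥0) x, toFun (a • x) = a * toFun x
  eq_zero : ∀ x, toFun x = 0 → x = 0
  mono : ∀ x y, x ≤ y → toFun x ≤ toFun y

namespace MonotoneNorm

instance {n : ℕ} : CoeFun (MonotoneNorm n) (fun _ => (Fin n → ℝ≥0) → ℝ≥0) := ⟨toFun⟩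

/-- The norm is invariant under permutations of the coordinates. -/
def IsSymmetric {n : ℕ} (ν : MonotoneNorm n) : Prop :=
  ∀ (π : Equiv.Perm (Fin n)) (x : Fin n → ℝ≥0), ν (x ∘ π) = ν x

/-- `σ = ‖(1, …, 1)‖ / max_i ‖e_i‖`. -/
noncomputable def sigma {n : ℕ} (ν : MonotoneNorm n) : ℝ≥0 :=
  ν 1 / ⨆ i, ν (Pi.single i 1)

/-- `ρ = ‖(1, …, 1)‖ / min_i ‖e_i‖`. -/
noncomputable def rho {n : ℕ} (ν : MonotoneNorm n) : ℝ≥0 :=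
  ν 1 / ⨅ i, ν (Pi.single i 1)

end MonotoneNorm

section FacilityLocation

/-- A deterministic online algorithm for facility location in `M` with `n` requests. On the request
sequence `x` and at time `i` it either opens no facility (`none`) or opens a facility at `q`
(`some q`), knowing only the requests up to and including time `i`. As no facility is open in the
beginning, it has to open one at the first request. -/
structure OnlineAlgorithm (M : Type*) (n : ℕ) where
  action : (Fin n → M) → Fin n → Option M
  causal : ∀ (x y : Fin n → M) (i : Fin n), (∀ j ≤ i, x j = y j) → action x i = action y i
  opens_first : ∀ (x : Fin n → M) (i : Fin n), (i : ℕ) = 0 → (action x i).isSome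

namespace OnlineAlgorithm

variable {M : Type*} {n : ℕ}

open Classical in
/-- `F_i`: the facilities opened until and including time `i`. -/
noncomputable def openUntil (A : OnlineAlgorithm M n) (x : Fin n → M) (i : Fin n) : Finset M :=
  (Finset.Iic i).biUnion fun j => (A.action x j).toFinset

open Classical in
/-- `F`: all facilities opened. -/
noncomputable def opened (A : OnlineAlgorithm M n) (x : Fin n → M) : Finset M :=
  Finset.univ.biUnion fun j => (A.action x j).toFinset

/-- The total cost `f |F| + ‖d‖` with `d_i = d(x_i, F_i)`. -/
noncomputable def cost [MetricSpace M] (ν : MonotoneNorm n) (f : ℝ≥0) (A : OnlineAlgorithm M n)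
    (x : Fin n → M) : ℝ≥0 :=
  f * (A.opened x).card + ν fun i => Metric.infNndist (x i) (A.openUntil x i : Set M)

end OnlineAlgorithm

/-- The cost of the best offline solution: the infimum of `f |F| + ‖(d(x_i, F))_i‖` over all
nonempty finite sets `F` of facilities. -/
noncomputable def offlineOpt {M : Type*} [MetricSpace M] {n : ℕ} (ν : MonotoneNorm n) (f : ℝ≥0)
    (x : Fin n → M) : ℝ≥0 :=
  ⨅ F : {F : Finset M // F.Nonempty},
    f * F.1.card + ν fun i => Metric.infNndist (x i) (F.1 : Set M)

universe u v

/-- A randomized online algorithm for the problem on `M` with norm `ν` and uniform opening cost `f`: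
a deterministic one that is chosen by a random seed in a probability space. -/
structure RandomizedOnlineAlgorithm (M : Type u) [MetricSpace M] {n : ℕ} (ν : MonotoneNorm n)
    (f : ℝ≥0) where
  Ω : Type v
  [measurableSpace : MeasurableSpace Ω]
  P : MeasureTheory.Measure Ω
  [isProbabilityMeasure : MeasureTheory.IsProbabilityMeasure P]
  alg : Ω → OnlineAlgorithm M n
  measurable_cost : ∀ x : Fin n → M, Measurable fun ω => (alg ω).cost ν f x

namespace RandomizedOnlineAlgorithm

attribute [instance] measurableSpace isProbabilityMeasure

variable {M : Type u} [MetricSpace M] {n : ℕ} {ν : MonotoneNorm n} {f : ℝ≥0}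

/-- The expected cost on the request sequence `x`. -/
noncomputable def expectedCost (A : RandomizedOnlineAlgorithm.{u, v} M ν f) (x : Fin n → M) :
    ℝ≥0∞ :=
  ∫⁻ ω, ((A.alg ω).cost ν f x : ℝ≥0∞) ∂A.P

/-- The expected cost is at most `r` times the offline optimum, on every request sequence. -/
def IsCompetitive (A : RandomizedOnlineAlgorithm.{u, v} M ν f) (r : ℝ≥0) : Prop :=
  ∀ x : Fin n → M, A.expectedCost x ≤ r * (offlineOpt ν f x : ℝ≥0∞)

end RandomizedOnlineAlgorithm

end FacilityLocation

/-- The vertices of the complete `N`-ary tree of height `k`: words of length at most `k` over `N`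
letters. The children of a word are its extensions by one letter, the root is the empty word. -/
@[ext] structure TreeVertex (k N : ℕ) where
  word : List (Fin N)
  length_le : word.length ≤ k

namespace TreeVertex

variable {k N : ℕ}

/-- The edges between `v` and the root; an edge is named by the word of its lower end. -/
def edges (v : TreeVertex k N) : Finset (List (Fin N)) :=
  (Finset.range v.word.length).image fun i => v.word.take (i + 1)

/-- The edges that go down from depth `j` (their lower end has depth `j + 1`) have length
`k⁻ʲ`. -/
noncomputable def edgeLength (k : ℕ) {N : ℕ} (e : List (Fin N)) : ℝ :=
  ((k : ℝ)⁻¹) ^ (e.length - 1)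

theorem edgeLength_nonneg (e : List (Fin N)) : 0 ≤ edgeLength k e := by
  unfold edgeLength; positivity

theorem edgeLength_pos {v : TreeVertex k N} {e : List (Fin N)} (he : e ∈ v.edges) :
    0 < edgeLength k e := by
  obtain ⟨i, hi, rfl⟩ := Finset.mem_image.1 he
  have h1 := Finset.mem_range.1 hi
  have h2 := v.length_le
  have : 0 < k := by omega
  unfold edgeLength; positivity

theorem word_mem_edges {v : TreeVertex k N} (h : v.word ≠ []) : v.word ∈ v.edges := by
  have := List.length_pos_iff.2 h
  refine Finset.mem_image.2 ⟨v.word.length - 1, Finset.mem_range.2 (by omega), ?_⟩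
  exact List.take_of_length_le (by omega)

theorem prefix_of_mem_edges {v : TreeVertex k N} {e : List (Fin N)} (he : e ∈ v.edges) :
    e <+: v.word := by
  obtain ⟨i, _, rfl⟩ := Finset.mem_image.1 he
  exact List.take_prefix _ _

theorem prefix_of_edges_eq {u v : TreeVertex k N} (h : u.edges = v.edges) :
    u.word <+: v.word := by
  by_cases hu : u.word = []
  · rw [hu]; exact List.nil_prefix
  · exact prefix_of_mem_edges (h ▸ word_mem_edges hu)

/-- The distance is the total length of the path between `u` and `v`, which consists of the edges
that lie on exactly one of their paths to the root. -/
noncomputable instance : MetricSpace (TreeVertex k N) where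
  dist u v := ∑ e ∈ symmDiff u.edges v.edges, edgeLength k e
  dist_self u := by simp
  dist_comm u v := by rw [symmDiff_comm]
  dist_triangle u v w := by
    refine (Finset.sum_le_sum_of_subset_of_nonneg (t := symmDiff u.edges v.edges ∪
      symmDiff v.edges w.edges) (symmDiff_triangle _ _ _)
      fun e _ _ => edgeLength_nonneg e).trans ?_
    rw [← Finset.sum_union_inter]
    exact le_add_of_nonneg_right (Finset.sum_nonneg fun e _ => edgeLength_nonneg e)
  eq_of_dist_eq_zero := by
    intro u v h
    have h0 := (Finset.sum_eq_zero_iff_of_nonneg fun e _ => edgeLength_nonneg e).1 h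
    have h1 : u.edges = v.edges := by
      rw [← symmDiff_eq_bot, Finset.bot_eq_empty, Finset.eq_empty_iff_forall_notMem]
      intro e he
      rcases Finset.mem_symmDiff.1 he with he' | he'
      · exact (edgeLength_pos he'.1).ne' (h0 e he)
      · exact (edgeLength_pos he'.1).ne' (h0 e he)
    have h2 := prefix_of_edges_eq h1
    have h3 := prefix_of_edges_eq h1.symm
    exact TreeVertex.ext (h2.eq_of_length (le_antisymm h2.length_le h3.length_le))

/-- The vertex `v_j` at depth `j` on the path `v_0 v_1 … v_k` from the root to the leaf `p`. -/
def onPath (p : Fin k → Fin N) (j : Fin (k + 1)) : TreeVertex k N where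
  word := (List.ofFn p).take j
  length_le := by simp

end TreeVertex

universe w

/-- Some uniform-cost online facility location problem with norm `ν` on a complete `N`-ary tree of
height `k` is such that every randomized online algorithm has competitive ratio at least `L`.
Moreover this is witnessed by a uniformly random root-to-leaf path, whose vertices are requested in
turn from the root to the leaf, each a fixed positive number of times: on average over the path, the
expected cost of the algorithm is at least `L` times the offline optimum. -/
def HasTreeLowerBound {n : ℕ} (ν : MonotoneNorm n) (L : ℝ) : Prop :=
  ∃ (k N : ℕ) (f : ℝ≥0) (level : Fin n → Fin (k + 1)),
    2 ≤ k ∧ 2 ≤ N ∧ 0 < f ∧ Monotone level ∧ Function.Surjective level ∧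
    ∀ A : RandomizedOnlineAlgorithm.{0, w} (TreeVertex k N) ν f,
      (∀ r : ℝ≥0, A.IsCompetitive r → L ≤ r) ∧
      ENNReal.ofReal L *
          ((∑ p : Fin k → Fin N,
            (offlineOpt ν f fun i => TreeVertex.onPath p (level i) : ℝ≥0∞)) / (N : ℝ≥0∞) ^ k) ≤
        (∑ p : Fin k → Fin N,
            A.expectedCost fun i => TreeVertex.onPath p (level i)) / (N : ℝ≥0∞) ^ k

/-! Take `k = 2 * q` of order log σ / log log σ, small enough that `4 * k ^ k ≤ σ`, and put `B = ν 1
/ k ^ k`. The prefix norm grows from 0 to `ν 1` in jumps of at most `m = max ‖e_i‖ ≤ B / 4`, so the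
requests can be cut into consecutive blocks, one per depth, in which depth `j` has norm at most `2 *
B * k ^ j` and every positive even depth has norm at least half of `B * k ^ j`
(`MonotoneNorm.exists_level`). Edge lengths `k⁻ʲ` cancel these weights: with a single facility at
the leaf each depth costs O(B). With opening cost `B * k`, the optimum is therefore at most `7 * (B
* k)` (`offlineOpt_onPath_le`).

An online algorithm does not know the next letter of the random path. If at some depth `2 * b + 2`
it has no facility below `v_{2b+1}`, all requests there are at distance at least `k ^ (-2b)`, which
costs at least `B * k ^ 2 / 2`. Otherwise it has such a facility for each of the `q` values of `b`.
Unless it guessed a letter in advance, these are different facilities, and opening them costs `q * B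
* k = B * k ^ 2 / 2` as well (`OnlineAlgorithm.le_cost_of_not_anticipates`). A guess made at one
time succeeds with probability at most `1 / N`, so for `N = 2 * q * n` a union bound leaves at least
half of the paths without a lucky guess (`OnlineAlgorithm.le_sum_cost`). The ratio is at least `k /
28`; averaging over the seed extends this to randomized algorithms. -/

namespace MonotoneNorm

variable {n : ℕ} (ν : MonotoneNorm n)

/-! ### Prefix norms and the division of the requests into levels. -/

theorem map_zero : ν 0 = 0 := by
  have := ν.smul_eq 0 0
  simpa using this

theorem sum_le {ι : Type*} (s : Finset ι) (g : ι → Fin n → ℝ≥0) :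
    ν (∑ j ∈ s, g j) ≤ ∑ j ∈ s, ν (g j) := by
  classical
  induction s using Finset.induction_on with
  | empty => simp [map_zero]
  | insert a s ha ih =>
    rw [Finset.sum_insert ha, Finset.sum_insert ha]
    exact (ν.add_le _ _).trans (by gcongr)

theorem indicator_mono {s t : Set (Fin n)} (h : s ⊆ t) :
    ν (s.indicator 1) ≤ ν (t.indicator 1) :=
  ν.mono _ _ (Set.indicator_le_indicator_of_subset h fun _ => zero_le)

theorem indicator_le_add {s t u : Set (Fin n)} (h : s ⊆ t ∪ u) :
    ν (s.indicator 1) ≤ ν (t.indicator 1) + ν (u.indicator 1) := by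
  refine (ν.mono _ (t.indicator 1 + u.indicator 1) fun i => ?_).trans (ν.add_le _ _)
  by_cases hs : i ∈ s
  · rcases h hs with ht | hu
    · simp [hs, ht]
    · simp [hs, hu]
  · simp [hs]

theorem indicator_subset_singleton {s : Set (Fin n)} {i : Fin n} (h : s ⊆ {i}) :
    ν (s.indicator 1) ≤ ν (Pi.single i 1) := by
  refine ν.mono _ _ fun j => ?_
  by_cases hj : j ∈ s
  · obtain rfl : j = i := h hj
    simp [hj]
  · simp [hj]

/-- The norm of the indicator of the first `t` coordinates. -/
noncomputable def prefixNorm (t : ℕ) : ℝ≥0 := ν ({i : Fin n | (i : ℕ) < t}.indicator 1)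

theorem prefixNorm_zero : ν.prefixNorm 0 = 0 := by
  refine Eq.trans (congrArg ν.toFun ?_) ν.map_zero
  funext i
  simp

theorem prefixNorm_self : ν.prefixNorm n = ν 1 := by
  simp [prefixNorm]

theorem prefixNorm_mono : Monotone ν.prefixNorm := fun _ _ h =>
  ν.indicator_mono fun _ hi => lt_of_lt_of_le hi h

theorem prefixNorm_succ_le {m : ℝ≥0} (hm : ∀ i, ν (Pi.single i 1) ≤ m) (t : ℕ) :
    ν.prefixNorm (t + 1) ≤ ν.prefixNorm t + m := by
  by_cases ht : t < n
  · refine (ν.indicator_le_add (t := {i : Fin n | (i : ℕ) < t}) (u := {⟨t, ht⟩})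
      fun i hi => ?_).trans (add_le_add le_rfl
        ((ν.indicator_subset_singleton le_rfl).trans (hm _)))
    rcases Nat.lt_succ_iff_lt_or_eq.1 hi with h | h
    · exact Or.inl h
    · exact Or.inr (Fin.ext h)
  · refine (ν.indicator_mono fun i _ => ?_).trans (self_le_add_right _ _)
    exact i.2.trans_le (not_lt.1 ht)

/-- Thresholds at which the prefix norm reaches `B * k ^ (2 * a)`. -/
theorem exists_thresholds {m B : ℝ≥0} {k q : ℕ} (hk : 2 ≤ k)
    (hm : ∀ i, ν (Pi.single i 1) ≤ m) (hmB : 4 * m ≤ B) (hB : 0 < B)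
    (htot : ν 1 = B * k ^ (2 * q)) :
    ∃ s : ℕ → ℕ, (∀ a ≤ q, s a ≤ n ∧ 1 ≤ s a ∧ B * k ^ (2 * a) ≤ ν.prefixNorm (s a) ∧
      ν.prefixNorm (s a) ≤ B * k ^ (2 * a) + m) ∧ ∀ a < q, s a + 1 < s (a + 1) := by
  classical
  have hk1 : (1 : ℝ≥0) ≤ k := by exact_mod_cast (by omega : 1 ≤ k)
  have hk2 : (2 : ℝ≥0) ≤ k := by exact_mod_cast hk
  have hex : ∀ a ≤ q, B * (k : ℝ≥0) ^ (2 * a) ≤ ν.prefixNorm n := fun a ha => by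
    rw [prefixNorm_self, htot]
    gcongr
  have key : ∀ a, ∃ t : ℕ, a ≤ q → t ≤ n ∧ 1 ≤ t ∧ B * k ^ (2 * a) ≤ ν.prefixNorm t ∧
      ν.prefixNorm t ≤ B * k ^ (2 * a) + m := by
    intro a
    by_cases ha : a ≤ q
    · have h := hex a ha
      have hE : ∃ t, B * (k : ℝ≥0) ^ (2 * a) ≤ ν.prefixNorm t := ⟨n, h⟩
      -- The least prefix reaching the target overshoots it by at most one jump `m`.
      refine ⟨Nat.find hE, fun _ => ⟨Nat.find_min' _ h, ?_, Nat.find_spec hE, ?_⟩⟩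
      · refine Nat.one_le_iff_ne_zero.2 fun h0 => ?_
        have h1 := Nat.find_spec hE
        rw [h0, prefixNorm_zero] at h1
        exact absurd h1 (not_le.2 (by positivity))
      · rcases Nat.eq_zero_or_pos (Nat.find hE) with h0 | h0
        · rw [h0, prefixNorm_zero]; exact zero_le
        · have h1 := ν.prefixNorm_succ_le hm (Nat.find hE - 1)
          rw [Nat.sub_add_cancel h0] at h1
          refine h1.trans (add_le_add (not_le.1 (Nat.find_min hE (Nat.sub_lt h0 one_pos))).le
            le_rfl)
    · exact ⟨0, fun h => absurd h ha⟩
  choose s hs using key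
  refine ⟨s, hs, fun a ha => ?_⟩
  -- Otherwise the prefix norm would grow from at most `X + m` to at least `4 * X` in one jump of
  -- size at most `m`; but `X ≥ B ≥ 4 * m`.
  by_contra! hcon
  have h1 := (hs (a + 1) ha).2.2.1
  have h2 := ν.prefixNorm_succ_le hm (s a)
  have h3 := (hs a ha.le).2.2.2
  have h4 := ν.prefixNorm_mono hcon
  have h5 : B * (k : ℝ≥0) ^ (2 * (a + 1)) = (k : ℝ≥0) ^ 2 * (B * k ^ (2 * a)) := by ring
  have h6 : (2 : ℝ≥0) ^ 2 ≤ (k : ℝ≥0) ^ 2 := by gcongr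
  have h7 : B * 1 ≤ B * (k : ℝ≥0) ^ (2 * a) := by gcongr; exact one_le_pow₀ hk1
  have h8 : (2 : ℝ≥0) ^ 2 * (B * k ^ (2 * a)) ≤ (k : ℝ≥0) ^ 2 * (B * k ^ (2 * a)) := by gcongr
  rw [h5] at h1
  set X := B * (k : ℝ≥0) ^ (2 * a)
  have h9 : (2 : ℝ≥0) ^ 2 * X ≤ X + m + m :=
    h8.trans (h1.trans (h4.trans (h2.trans (add_le_add h3 le_rfl))))
  rw [← NNReal.coe_le_coe] at h9 h7 hmB
  rw [← NNReal.coe_lt_coe] at hB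
  push_cast at h9 h7 hmB hB
  linarith

/-- A partition of the coordinates into consecutive intervals, in which the odd levels are singletons
and the norm of the even level `2 * a` is of the order of `B * k ^ (2 * a)`. -/
theorem exists_level {m B : ℝ≥0} {k q : ℕ} (hk : 2 ≤ k)
    (hm : ∀ i, ν (Pi.single i 1) ≤ m) (hmB : 4 * m ≤ B) (hB : 0 < B)
    (htot : ν 1 = B * k ^ (2 * q)) :
    ∃ level : Fin n → Fin (2 * q + 1), Monotone level ∧ Function.Surjective level ∧
      (∀ j, ν ({i | level i = j}.indicator 1) ≤ 2 * B * k ^ (j : ℕ)) ∧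
      ∀ b < q, B * k ^ (2 * b + 2) ≤ 2 * ν ({i | (level i : ℕ) = 2 * b + 2}.indicator 1) := by
  obtain ⟨s, hs, hstep⟩ := ν.exists_thresholds hk hm hmB hB htot
  have hmono : ∀ a b, a < b → b ≤ q → s a + 1 < s b := by
    intro a b hab hb
    induction b, hab using Nat.le_induction with
    | base => exact hstep a hb
    | succ b hab ih =>
      have := ih (by omega)
      have := hstep b hb
      omega
  have hmono' : ∀ a b, a ≤ b → b ≤ q → s a ≤ s b := fun a b hab hb => by
    rcases hab.eq_or_lt with rfl | h
    · rfl
    · have := hmono a b h hb; omega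
  -- The level of `i` will be `c₁ i + c₂ i`. At the threshold `s b` only `c₁` has stepped, which
  -- gives the singleton level `2 * b + 1`; one coordinate later `c₂` has followed.
  let c₁ : ℕ → ℕ := fun i => ((Finset.range q).filter fun a => s a ≤ i).card
  let c₂ : ℕ → ℕ := fun i => ((Finset.range q).filter fun a => s a < i).card
  have hc₁ : ∀ i, c₁ i ≤ q := fun i => (Finset.card_filter_le _ _).trans (by simp)
  have hc₂ : ∀ i, c₂ i ≤ q := fun i => (Finset.card_filter_le _ _).trans (by simp)
  have lower₁ : ∀ i a, a < q → s a ≤ i → a + 1 ≤ c₁ i := fun i a ha h => by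
    rw [← Finset.card_range (a + 1)]
    refine Finset.card_le_card fun b hb => Finset.mem_filter.2 ⟨?_, ?_⟩
    · simp at hb ⊢; omega
    · exact (hmono' b a (by simp at hb; omega) ha.le).trans h
  have lower₂ : ∀ i a, a < q → s a < i → a + 1 ≤ c₂ i := fun i a ha h => by
    rw [← Finset.card_range (a + 1)]
    refine Finset.card_le_card fun b hb => Finset.mem_filter.2 ⟨?_, ?_⟩
    · simp at hb ⊢; omega
    · exact (hmono' b a (by simp at hb; omega) ha.le).trans_lt h
  have upper₁ : ∀ i a, a ≤ q → i < s a → c₁ i ≤ a := fun i a ha h => by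
    conv_rhs => rw [← Finset.card_range a]
    refine Finset.card_le_card fun b hb => ?_
    obtain ⟨hb1, hb2⟩ := Finset.mem_filter.1 hb
    simp only [Finset.mem_range] at hb1 ⊢
    by_contra! hab
    have := hmono' a b hab hb1.le
    omega
  have upper₂ : ∀ i a, a ≤ q → i ≤ s a → c₂ i ≤ a := fun i a ha h => by
    conv_rhs => rw [← Finset.card_range a]
    refine Finset.card_le_card fun b hb => ?_
    obtain ⟨hb1, hb2⟩ := Finset.mem_filter.1 hb
    simp only [Finset.mem_range] at hb1 ⊢
    by_contra! hab
    have := hmono' a b hab hb1.le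
    omega
  have lower₂' : ∀ i a, a < q → s a ≤ i → a ≤ c₂ i := fun i a ha h => by
    rcases a with _ | a
    · exact Nat.zero_le _
    · exact lower₂ i a (by omega) (by have := hstep a (by omega); omega)
  have upper₁' : ∀ i a, a < q → i ≤ s a → c₁ i ≤ a + 1 := fun i a ha h =>
    upper₁ i (a + 1) ha (by have := hstep a ha; omega)
  let level : Fin n → Fin (2 * q + 1) := fun i =>
    ⟨c₁ i + c₂ i, by have := hc₁ i; have := hc₂ i; omega⟩
  have odd_eq : ∀ (i : Fin n) b, b < q → (level i : ℕ) = 2 * b + 1 → (i : ℕ) = s b := by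
    intro i b hb h
    change c₁ i + c₂ i = _ at h
    rcases lt_trichotomy (i : ℕ) (s b) with h1 | h1 | h1
    · have := upper₁ i b hb.le h1; have := upper₂ i b hb.le h1.le; omega
    · exact h1
    · have := lower₁ i b hb h1.le; have := lower₂ i b hb h1; omega
  have even_lt : ∀ (i : Fin n) b, b < q → (level i : ℕ) = 2 * b → (i : ℕ) < s b := by
    intro i b hb h
    change c₁ i + c₂ i = _ at h
    by_contra! h1
    have := lower₁ i b hb h1; have := lower₂' i b hb h1; omega
  have even_of : ∀ (i : Fin n) b, b < q → s b < i → (i : ℕ) < s (b + 1) →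
      (level i : ℕ) = 2 * b + 2 := by
    intro i b hb h1 h2
    change c₁ i + c₂ i = _
    have := lower₁ i b hb h1.le; have := lower₂ i b hb h1
    have := upper₁ i (b + 1) hb h2; have := upper₂ i (b + 1) hb h2.le; omega
  have odd_of : ∀ (i : Fin n) b, b < q → (i : ℕ) = s b → (level i : ℕ) = 2 * b + 1 := by
    intro i b hb h1
    change c₁ i + c₂ i = _
    have := lower₁ i b hb h1.ge; have := lower₂' i b hb h1.ge
    have := upper₁' i b hb h1.le; have := upper₂ i b hb.le h1.le; omega
  have hk1 : (1 : ℝ≥0) ≤ k := by exact_mod_cast (by omega : 1 ≤ k)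
  have hk2 : (2 : ℝ≥0) ≤ k := by exact_mod_cast hk
  have hBk : ∀ e : ℕ, B ≤ B * (k : ℝ≥0) ^ e := fun e => le_mul_of_one_le_right' (one_le_pow₀ hk1)
  have hmB' : m ≤ B := (le_mul_of_one_le_left' (by norm_num)).trans hmB
  refine ⟨level, ?_, ?_, ?_, ?_⟩
  · intro i j hij
    have hij' : (i : ℕ) ≤ j := hij
    refine Fin.mk_le_mk.2 (add_le_add (Finset.card_le_card ?_) (Finset.card_le_card ?_))
    · exact Finset.monotone_filter_right _ fun a _ h => h.trans hij'
    · exact Finset.monotone_filter_right _ fun a _ h => h.trans_le hij'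
  · intro j
    have hj := j.2
    rcases Nat.even_or_odd' (j : ℕ) with ⟨b, hb | hb⟩
    · rcases b with _ | b
      · have h0 := hs 0 (Nat.zero_le _)
        have hi : 0 < n := by omega
        refine ⟨⟨0, hi⟩, Fin.ext ?_⟩
        change c₁ 0 + c₂ 0 = _
        have := upper₁ 0 0 (Nat.zero_le _) (by omega)
        have := upper₂ 0 0 (Nat.zero_le _) (by omega)
        omega
      · have h1 := hstep b (by omega)
        have h2 := (hs (b + 1) (by omega)).1
        refine ⟨⟨s b + 1, by omega⟩, Fin.ext ?_⟩
        rw [even_of _ b (by omega) (Nat.lt_succ_self _) h1]; omega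
    · have h1 := hstep b (by omega)
      have h2 := (hs (b + 1) (by omega)).1
      exact ⟨⟨s b, by omega⟩, Fin.ext (by rw [odd_of _ b (by omega) rfl]; omega)⟩
  · intro j
    have hj := j.2
    have h2B : B * (k : ℝ≥0) ^ (j : ℕ) + m ≤ 2 * B * k ^ (j : ℕ) := by
      rw [mul_assoc, two_mul (B * _)]
      gcongr
      exact hmB'.trans (hBk _)
    refine le_trans ?_ h2B
    rcases Nat.even_or_odd' (j : ℕ) with ⟨b, hb | hb⟩
    -- Only the thresholds with index below `q` are counted, so the top level extends to the last
    -- coordinate, possibly beyond `s q`. It is bounded by the norm of the all-ones vector.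
    · rcases (show b ≤ q by omega).eq_or_lt with rfl | hbq
      · rw [hb, ← htot]
        refine (ν.mono _ _ fun i => ?_).trans (self_le_add_right _ _)
        exact Set.indicator_le_self' (fun _ _ => zero_le) i
      · rw [hb]
        refine (ν.indicator_mono fun i hi => ?_).trans (hs b hbq.le).2.2.2
        exact even_lt i b hbq (by rw [show level i = j from hi, hb])
    · have h1 := hstep b (by omega)
      have h2 := (hs (b + 1) (by omega)).1
      refine ((ν.indicator_subset_singleton (i := ⟨s b, by omega⟩) fun i hi => ?_).trans
        (hm _)).trans (self_le_add_left _ _)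
      exact Fin.ext (odd_eq i b (by omega) (by rw [show level i = j from hi, hb]))
  · intro b hb
    -- The part up to and including `s b` has norm at most `X + 2 * m ≤ 3 * X / 2`, while the whole
    -- prefix has norm at least `Y ≥ 4 * X`; more than half of `Y` is left for the level.
    have h1 : ν.prefixNorm (s (b + 1)) ≤ ν.prefixNorm (s b + 1) +
        ν ({i | (level i : ℕ) = 2 * b + 2}.indicator 1) := by
      refine ν.indicator_le_add fun i hi => ?_
      by_cases h : (i : ℕ) < s b + 1
      · exact Or.inl h
      · exact Or.inr (even_of i b hb (by omega) hi)
    have h2 := ν.prefixNorm_succ_le hm (s b)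
    have h3 := (hs b hb.le).2.2.2
    have h4 := (hs (b + 1) hb).2.2.1
    have h5 : B * (k : ℝ≥0) ^ (2 * b + 2) = (k : ℝ≥0) ^ 2 * (B * k ^ (2 * b)) := by ring
    have h6 : (2 : ℝ≥0) ^ 2 ≤ (k : ℝ≥0) ^ 2 := by gcongr
    have h8 : (2 : ℝ≥0) ^ 2 * (B * k ^ (2 * b)) ≤ (k : ℝ≥0) ^ 2 * (B * k ^ (2 * b)) := by gcongr
    have h7 := hBk (2 * b)
    rw [mul_add, mul_one] at h4
    rw [← h5] at h8
    set X := B * (k : ℝ≥0) ^ (2 * b)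
    set Y := B * (k : ℝ≥0) ^ (2 * b + 2)
    rw [← NNReal.coe_le_coe] at *
    push_cast at *
    linarith

end MonotoneNorm
-- Distances from the vertices of a root-to-leaf path.
theorem sum_Ico_pow_le {r : ℝ} (h0 : 0 ≤ r) (h1 : r ≤ 1 / 2) {j m : ℕ} (h : j ≤ m) :
    ∑ i ∈ Finset.Ico j m, r ^ i ≤ 2 * r ^ j := by
  suffices H : ∑ i ∈ Finset.Ico j m, r ^ i + 2 * r ^ m ≤ 2 * r ^ j from
    le_trans (le_add_of_nonneg_right (by positivity)) H
  induction m, h using Nat.le_induction with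
  | base => simp
  | succ m hm ih =>
    rw [Finset.sum_Ico_succ_top hm, pow_succ]
    have := mul_le_mul_of_nonneg_left h1 (pow_nonneg h0 m)
    linarith

namespace TreeVertex

variable {k N : ℕ}

theorem edges_onPath (p : Fin k → Fin N) (j : Fin (k + 1)) :
    (onPath p j).edges = (Finset.range j).image fun i => (List.ofFn p).take (i + 1) := by
  have hj := Nat.lt_succ_iff.1 j.2
  unfold edges onPath
  simp only [List.length_take, List.length_ofFn, min_eq_left hj]
  refine Finset.image_congr fun i hi => ?_
  have hi' : i < j := by simpa using hi
  simp [List.take_take, min_eq_left (Nat.succ_le_of_lt hi')]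

theorem edgeLength_take (p : Fin k → Fin N) {i : ℕ} (hi : i < k) :
    edgeLength k ((List.ofFn p).take (i + 1)) = ((k : ℝ)⁻¹) ^ i := by
  unfold edgeLength
  simp [min_eq_left (Nat.succ_le_of_lt hi)]

theorem nndist_onPath_last_le (hk : 2 ≤ k) (p : Fin k → Fin N) (j : Fin (k + 1)) :
    nndist (onPath p j) (onPath p (Fin.last k)) ≤ 2 * ((k : ℝ≥0)⁻¹) ^ (j : ℕ) := by
  classical
  have hj := Nat.lt_succ_iff.1 j.2
  have hr : (k : ℝ)⁻¹ ≤ 1 / 2 := by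
    rw [one_div]
    exact inv_anti₀ two_pos (by exact_mod_cast hk)
  rw [← NNReal.coe_le_coe, coe_nndist]
  push_cast
  change ∑ e ∈ symmDiff (onPath p j).edges (onPath p (Fin.last k)).edges, edgeLength k e ≤ _
  have hsub : symmDiff (onPath p j).edges (onPath p (Fin.last k)).edges ⊆
      (Finset.Ico (j : ℕ) k).image fun i => (List.ofFn p).take (i + 1) := by
    intro e he
    simp only [edges_onPath, Finset.mem_symmDiff, Finset.mem_image, Finset.mem_range,
      Fin.val_last, Finset.mem_Ico] at he ⊢
    rcases he with ⟨⟨i, hi, rfl⟩, h⟩ | ⟨⟨i, hi, rfl⟩, h⟩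
    · exact absurd ⟨i, by omega, rfl⟩ h
    · refine ⟨i, ⟨?_, hi⟩, rfl⟩
      by_contra! hlt
      exact h ⟨i, hlt, rfl⟩
  refine (Finset.sum_le_sum_of_subset_of_nonneg hsub fun e _ _ => edgeLength_nonneg e).trans ?_
  rw [Finset.sum_image]
  · rw [Finset.sum_congr rfl fun i hi => edgeLength_take p (Finset.mem_Ico.1 hi).2]
    exact sum_Ico_pow_le (by positivity) hr hj
  · intro a ha b hb hab
    have ha' := (Finset.mem_Ico.1 ha).2
    have hb' := (Finset.mem_Ico.1 hb).2
    have := congrArg List.length hab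
    simp at this
    omega

/-- The edge of the path from depth `l` to depth `l + 1` separates the two points and alone has this
length. -/
theorem le_nndist_onPath (p : Fin k → Fin N) {l : ℕ} {j : Fin (k + 1)} (hl : l < j)
    {z : TreeVertex k N} (hz : ¬ (List.ofFn p).take (l + 1) <+: z.word) :
    ((k : ℝ≥0)⁻¹) ^ l ≤ nndist (onPath p j) z := by
  classical
  have hj := Nat.lt_succ_iff.1 j.2
  rw [← NNReal.coe_le_coe, coe_nndist]
  push_cast
  change _ ≤ ∑ e ∈ symmDiff (onPath p j).edges z.edges, edgeLength k e
  rw [← edgeLength_take p (hl.trans_le hj)]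
  refine Finset.single_le_sum (fun e _ => edgeLength_nonneg e) (Finset.mem_symmDiff.2 (Or.inl ⟨?_, ?_⟩))
  · rw [edges_onPath]
    exact Finset.mem_image.2 ⟨l, Finset.mem_range.2 hl, rfl⟩
  · exact fun h => hz (prefix_of_mem_edges h)

theorem onPath_congr {p p' : Fin k → Fin N} {j : Fin (k + 1)}
    (h : ∀ i : Fin k, (i : ℕ) < j → p i = p' i) : onPath p j = onPath p' j := by
  refine TreeVertex.ext (List.ext_getElem (by simp [onPath]) fun i h1 h2 => ?_)
  simp only [onPath, List.getElem_take, List.getElem_ofFn]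
  refine h _ ?_
  simp [onPath] at h1
  exact h1.1

end TreeVertex

/-! ### Elementary bounds on the online and offline costs. -/

section FacilityLocation

variable {M : Type*} {n : ℕ}

theorem OnlineAlgorithm.mem_openUntil {A : OnlineAlgorithm M n} {x : Fin n → M} {i : Fin n}
    {z : M} : z ∈ A.openUntil x i ↔ ∃ j ≤ i, A.action x j = some z := by
  simp [openUntil]

theorem OnlineAlgorithm.openUntil_subset (A : OnlineAlgorithm M n) (x : Fin n → M) (i : Fin n) :
    A.openUntil x i ⊆ A.opened x := by
  classical
  exact Finset.biUnion_subset_biUnion_of_subset_left _ (Finset.subset_univ _)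

theorem OnlineAlgorithm.openUntil_nonempty (A : OnlineAlgorithm M n) (x : Fin n → M) (i : Fin n) :
    (A.openUntil x i).Nonempty := by
  obtain ⟨z, hz⟩ := Option.isSome_iff_exists.1 (A.opens_first x ⟨0, i.pos⟩ rfl)
  exact ⟨z, mem_openUntil.2 ⟨_, Nat.zero_le _, hz⟩⟩

variable [MetricSpace M]

theorem offlineOpt_le_cost (ν : MonotoneNorm n) (f : ℝ≥0) (hn : 0 < n)
    (A : OnlineAlgorithm M n) (x : Fin n → M) : offlineOpt ν f x ≤ A.cost ν f x := by
  have hne : (A.opened x).Nonempty :=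
    (A.openUntil_nonempty x ⟨0, hn⟩).mono (A.openUntil_subset x _)
  refine (ciInf_le (OrderBot.bddBelow _) ⟨A.opened x, hne⟩).trans (add_le_add le_rfl ?_)
  refine ν.mono _ _ fun i => ?_
  rw [← NNReal.coe_le_coe, Metric.coe_infNndist, Metric.coe_infNndist]
  exact Metric.infDist_le_infDist_of_subset (by exact_mod_cast A.openUntil_subset x i)
    (by exact_mod_cast A.openUntil_nonempty x i)

theorem le_offlineOpt [Nonempty M] (ν : MonotoneNorm n) (f : ℝ≥0) (x : Fin n → M) :
    f ≤ offlineOpt ν f x := by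
  have : Nonempty {F : Finset M // F.Nonempty} := ⟨⟨{Classical.arbitrary M}, by simp⟩⟩
  refine le_ciInf fun F => le_trans ?_ (self_le_add_right _ _)
  exact le_mul_of_one_le_right' (by exact_mod_cast F.2.card_pos)

theorem offlineOpt_le_singleton (ν : MonotoneNorm n) (f : ℝ≥0) (x : Fin n → M) (z : M) :
    offlineOpt ν f x ≤ f + ν fun i => nndist (x i) z := by
  refine (ciInf_le (OrderBot.bddBelow _) ⟨{z}, by simp⟩).trans ?_
  have h : ∀ i, Metric.infNndist (x i) ({z} : Set M) = nndist (x i) z := fun i => by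
    rw [← NNReal.coe_inj, Metric.coe_infNndist, Metric.infDist_singleton, coe_nndist]
  simp only [Finset.card_singleton, Nat.cast_one, mul_one, Finset.coe_singleton, h, le_refl]

end FacilityLocation

/-! ### Passage from deterministic to randomized algorithms. -/

/-- This is the easy direction of Yao's principle: integrate the bound for the deterministic
algorithms over the seed and exchange the integral with the finite sum over paths. The competitive
ratio follows by cancelling the total optimum, which is positive because every solution opens a
facility. -/
theorem hasTreeLowerBound_of_forall_deterministic {n : ℕ} {ν : MonotoneNorm n} {L : ℝ} {k N : ℕ}
    {f : ℝ≥0} (level : Fin n → Fin (k + 1)) (hk : 2 ≤ k) (hN : 2 ≤ N) (hf : 0 < f)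
    (hmono : Monotone level) (hsurj : Function.Surjective level)
    (H : ∀ A : OnlineAlgorithm (TreeVertex k N) n,
      L.toNNReal * ∑ p : Fin k → Fin N, offlineOpt ν f (fun i => TreeVertex.onPath p (level i)) ≤
        ∑ p : Fin k → Fin N, A.cost ν f fun i => TreeVertex.onPath p (level i)) :
    HasTreeLowerBound.{w} ν L := by
  have : NeZero N := ⟨by omega⟩
  have : Nonempty (TreeVertex k N) := ⟨⟨[], by simp⟩⟩
  refine ⟨k, N, f, level, hk, hN, hf, hmono, hsurj, fun A => ?_⟩
  set x : (Fin k → Fin N) → Fin n → TreeVertex k N := fun p i => TreeVertex.onPath p (level i)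
  have key : (L.toNNReal : ℝ≥0∞) * ∑ p, (offlineOpt ν f (x p) : ℝ≥0∞) ≤
      ∑ p, A.expectedCost (x p) := by
    unfold RandomizedOnlineAlgorithm.expectedCost
    rw [← MeasureTheory.lintegral_finsetSum _ fun p _ => (A.measurable_cost (x p)).coe_nnreal_ennreal]
    calc _ = ∫⁻ _, (L.toNNReal : ℝ≥0∞) * ∑ p, (offlineOpt ν f (x p) : ℝ≥0∞) ∂A.P := by simp
      _ ≤ _ := MeasureTheory.lintegral_mono fun ω => by
          have h := ENNReal.coe_le_coe.2 (H (A.alg ω))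
          push_cast at h
          exact h
  refine ⟨fun r hr => ?_, ?_⟩
  · have h1 : (L.toNNReal : ℝ≥0∞) * ∑ p, (offlineOpt ν f (x p) : ℝ≥0∞) ≤
        r * ∑ p, (offlineOpt ν f (x p) : ℝ≥0∞) := by
      refine key.trans ?_
      rw [Finset.mul_sum]
      exact Finset.sum_le_sum fun p _ => hr (x p)
    have h2 : L.toNNReal * ∑ p, offlineOpt ν f (x p) ≤ r * ∑ p, offlineOpt ν f (x p) := by
      exact_mod_cast h1
    have h3 : 0 < ∑ p, offlineOpt ν f (x p) :=
      Finset.sum_pos (fun p _ => hf.trans_le (le_offlineOpt ν f _)) Finset.univ_nonempty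
    exact Real.toNNReal_le_iff_le_coe.1 (le_of_mul_le_mul_right h2 h3)
  · rw [← mul_div_assoc]
    exact ENNReal.div_le_div_right key _
-- The average cost of a deterministic algorithm.
namespace OnlineAlgorithm

open TreeVertex

variable {n k N : ℕ}

/-- On the path `p`, the facility opened at time `j` lies below the vertex of `p` at depth `l`. -/
def Anticipates (A : OnlineAlgorithm (TreeVertex k N) n) (level : Fin n → Fin (k + 1))
    (p : Fin k → Fin N) (l : ℕ) (j : Fin n) : Prop :=
  ∃ z, A.action (fun i => onPath p (level i)) j = some z ∧ (List.ofFn p).take l <+: z.word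

-- Up to time `j` the requests reveal only letters before position `l`. Once the other letters are
-- fixed, the facility opened at time `j` is therefore fixed too, and it can lie below the right
-- child for only one value of letter `l`; so forgetting that letter is injective on these paths.
open Classical in
theorem card_anticipates_le (A : OnlineAlgorithm (TreeVertex k N) n)
    {level : Fin n → Fin (k + 1)} (hmono : Monotone level) (l : Fin k) {j : Fin n}
    (hj : (level j : ℕ) ≤ l) :
    (Finset.univ.filter fun p => A.Anticipates level p (l + 1) j).card ≤ N ^ (k - 1) := by
  have hcard : (Finset.univ : Finset ({i : Fin k // i ≠ l} → Fin N)).card = N ^ (k - 1) := by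
    simp [Fintype.card_subtype_compl]
  rw [← hcard]
  refine Finset.card_le_card_of_injOn (fun p i => p i.1) (fun _ _ => Finset.mem_univ _) ?_
  intro p hp p' hp' hpp
  have hne : ∀ i, i ≠ l → p i = p' i := fun i hi => congrFun hpp ⟨i, hi⟩
  obtain ⟨z, hz, hpre⟩ := (Finset.mem_filter.1 hp).2
  obtain ⟨z', hz', hpre'⟩ := (Finset.mem_filter.1 hp').2
  have hact := A.causal (fun i => onPath p (level i)) (fun i => onPath p' (level i)) j
    fun i hi => onPath_congr fun a ha => hne a (by
      rintro rfl
      have : (level i : ℕ) ≤ level j := hmono hi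
      omega)
  rw [hz, hz', Option.some_inj] at hact
  subst hact
  have hl := l.2
  have htake : (List.ofFn p).take (l + 1) = (List.ofFn p').take (l + 1) :=
    List.IsPrefix.eq_of_length (List.prefix_of_prefix_length_le hpre hpre' (by simp)) (by simp)
  funext i
  by_cases hi : i = l
  · subst hi
    have h1 : ((List.ofFn p).take (i + 1))[(i : ℕ)]? = ((List.ofFn p').take (i + 1))[(i : ℕ)]? := by
      rw [htake]
    simpa [List.getElem?_take, List.getElem?_ofFn, hl] using h1
  · exact hne i hi

open Classical in
theorem card_exists_anticipates_le (A : OnlineAlgorithm (TreeVertex k N) n)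
    {level : Fin n → Fin (k + 1)} (hmono : Monotone level) {q : ℕ} (hq : k = 2 * q) :
    (Finset.univ.filter fun p => ∃ b < q, ∃ j, (level j : ℕ) ≤ 2 * b ∧
      A.Anticipates level p (2 * b + 1) j).card ≤ q * (n * N ^ (k - 1)) := by
  have hsub : (Finset.univ.filter fun p => ∃ b < q, ∃ j, (level j : ℕ) ≤ 2 * b ∧
      A.Anticipates level p (2 * b + 1) j) ⊆ (Finset.range q).biUnion fun b =>
        (Finset.univ : Finset (Fin n)).biUnion fun j => Finset.univ.filter fun p =>
          (level j : ℕ) ≤ 2 * b ∧ A.Anticipates level p (2 * b + 1) j := by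
    intro p hp
    simpa using hp
  refine (Finset.card_le_card hsub).trans ?_
  refine (Finset.card_biUnion_le_card_mul _ _ (n * N ^ (k - 1)) fun b hb => ?_).trans (by simp)
  refine (Finset.card_biUnion_le_card_mul _ _ (N ^ (k - 1)) fun j _ => ?_).trans (by simp)
  have hb' := Finset.mem_range.1 hb
  by_cases hj : (level j : ℕ) ≤ 2 * b
  · refine le_trans (Finset.card_le_card fun p hp => ?_)
      (A.card_anticipates_le hmono ⟨2 * b, by omega⟩ hj)
    simp only [Finset.mem_filter, Finset.mem_univ, true_and] at hp ⊢
    exact hp.2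
  · simp [hj]

/-- The opening cost `B * k` is chosen so that missing one even depth and opening `q = k / 2`
facilities both cost `B * k ^ 2 / 2`. -/
theorem le_cost_of_not_anticipates (A : OnlineAlgorithm (TreeVertex k N) n) (ν : MonotoneNorm n)
    {level : Fin n → Fin (k + 1)} (hmono : Monotone level) {q : ℕ} (hq : k = 2 * q) (hk : 0 < k)
    {B : ℝ≥0}
    (hB : ∀ b < q, B * k ^ (2 * b + 2) ≤ 2 * ν ({i | (level i : ℕ) = 2 * b + 2}.indicator 1))
    {p : Fin k → Fin N}
    (hp : ¬ ∃ b < q, ∃ j, (level j : ℕ) ≤ 2 * b ∧ A.Anticipates level p (2 * b + 1) j) :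
    B * k ^ 2 ≤ 2 * A.cost ν (B * k) fun i => onPath p (level i) := by
  set x : Fin n → TreeVertex k N := fun i => onPath p (level i)
  have hk0 : (k : ℝ≥0) ≠ 0 := by exact_mod_cast hk.ne'
  by_cases hmiss : ∃ b < q, ∀ i, (level i : ℕ) = 2 * b + 2 → ∀ z ∈ A.openUntil x i,
      ¬ (List.ofFn p).take (2 * b + 1) <+: z.word
  · obtain ⟨b, hb, hmiss⟩ := hmiss
    -- At a missed depth the edge leaving depth `2 * b` separates every open facility from the
    -- request.
    have hle : (((k : ℝ≥0)⁻¹) ^ (2 * b)) • ({i | (level i : ℕ) = 2 * b + 2}.indicator 1) ≤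
        fun i => Metric.infNndist (x i) (A.openUntil x i : Set (TreeVertex k N)) := by
      intro i
      by_cases hi : (level i : ℕ) = 2 * b + 2
      · simp only [Pi.smul_apply, Set.mem_ofPred_eq, hi, Set.indicator_of_mem, Pi.one_apply,
          smul_eq_mul, mul_one]
        rw [← NNReal.coe_le_coe, Metric.coe_infNndist]
        refine (Metric.le_infDist (by exact_mod_cast A.openUntil_nonempty x i)).2 fun z hz => ?_
        rw [← coe_nndist, NNReal.coe_le_coe]
        exact le_nndist_onPath p (by omega) (hmiss i hi z hz)
      · simp [hi]
    have h1 := ν.mono _ _ hle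
    rw [ν.smul_eq] at h1
    have h2 : B * (k : ℝ≥0) ^ 2 = ((k : ℝ≥0)⁻¹) ^ (2 * b) * (B * k ^ (2 * b + 2)) := by
      rw [pow_add, inv_pow]
      field_simp
    calc B * (k : ℝ≥0) ^ 2 = ((k : ℝ≥0)⁻¹) ^ (2 * b) * (B * k ^ (2 * b + 2)) := h2
      _ ≤ ((k : ℝ≥0)⁻¹) ^ (2 * b) * (2 * ν ({i | (level i : ℕ) = 2 * b + 2}.indicator 1)) := by
        exact mul_le_mul' le_rfl (hB b hb)
      _ = 2 * (((k : ℝ≥0)⁻¹) ^ (2 * b) * ν ({i | (level i : ℕ) = 2 * b + 2}.indicator 1)) := by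
        ring
      _ ≤ _ := by
        unfold cost
        gcongr
        exact h1.trans (self_le_add_left _ _)
  · push Not at hmiss
    have hhit : ∀ b : Fin q, ∃ i, (level i : ℕ) = 2 * b + 2 ∧ ∃ z ∈ A.openUntil x i,
        (List.ofFn p).take (2 * b + 1) <+: z.word := fun b => hmiss b b.2
    choose i hi z hz hpre using hhit
    -- The facility `z b` is open by the time of a request at depth `2 * b + 2 ≤ 2 * b'`. If it also
    -- served `b'`, it would anticipate the letter leading to depth `2 * b' + 1`. The odd depth in
    -- between lets that letter be revealed before depth `2 * b' + 2` is tested.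
    have hne : ∀ b b', b < b' → z b ≠ z b' := by
      intro b b' hbb heq
      obtain ⟨j, hj, hact⟩ := mem_openUntil.1 (hz b)
      refine hp ⟨b', b'.2, j, ?_, z b', heq ▸ hact, hpre b'⟩
      have h1 : (level j : ℕ) ≤ level (i b) := hmono hj
      have h2 := hi b
      have h3 : (b : ℕ) < b' := hbb
      omega
    have hcard : q ≤ (A.opened x).card := by
      rw [← Fintype.card_fin q, ← Finset.card_univ]
      refine Finset.card_le_card_of_injOn z (fun b _ => A.openUntil_subset x (i b) (hz b)) ?_
      intro b _ b' _ h
      rcases lt_trichotomy b b' with hlt | heq | hlt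
      · exact absurd h (hne b b' hlt)
      · exact heq
      · exact absurd h.symm (hne b' b hlt)
    calc B * (k : ℝ≥0) ^ 2 = 2 * (B * k * q) := by
          have : (k : ℝ≥0) = 2 * q := by exact_mod_cast hq
          rw [this]; ring
      _ ≤ 2 * (B * k * (A.opened x).card) := by gcongr
      _ ≤ _ := by
        unfold cost
        gcongr
        exact self_le_add_right _ _

theorem le_sum_cost (A : OnlineAlgorithm (TreeVertex k N) n) (ν : MonotoneNorm n)
    {level : Fin n → Fin (k + 1)} (hmono : Monotone level) {q : ℕ} (hq : k = 2 * q) (hk : 0 < k)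
    (hN : 2 * (q * n) ≤ N) {B : ℝ≥0}
    (hB : ∀ b < q, B * k ^ (2 * b + 2) ≤ 2 * ν ({i | (level i : ℕ) = 2 * b + 2}.indicator 1)) :
    (N : ℝ≥0) ^ k * (B * k ^ 2) ≤
      4 * ∑ p : Fin k → Fin N, A.cost ν (B * k) fun i => onPath p (level i) := by
  classical
  -- `U` consists of the paths with a lucky guess; their cost is simply dropped.
  set U : Finset (Fin k → Fin N) := Finset.univ.filter fun p => ∃ b < q, ∃ j,
    (level j : ℕ) ≤ 2 * b ∧ A.Anticipates level p (2 * b + 1) j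
  have hU : 2 * U.card ≤ N ^ k := by
    calc 2 * U.card ≤ 2 * (q * (n * N ^ (k - 1))) :=
          Nat.mul_le_mul_left _ (A.card_exists_anticipates_le hmono hq)
      _ = 2 * (q * n) * N ^ (k - 1) := by ring
      _ ≤ N * N ^ (k - 1) := Nat.mul_le_mul_right _ hN
      _ = N ^ k := by rw [← pow_succ', Nat.sub_add_cancel hk]
  have hUc : U.card + Uᶜ.card = N ^ k := by simp [Finset.card_add_card_compl]
  have hUc' : (N : ℝ≥0) ^ k ≤ 2 * Uᶜ.card := by exact_mod_cast (by omega : N ^ k ≤ 2 * Uᶜ.card)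
  calc (N : ℝ≥0) ^ k * (B * k ^ 2) ≤ 2 * Uᶜ.card * (B * k ^ 2) := by gcongr
    _ = 2 * ∑ p ∈ Uᶜ, B * (k : ℝ≥0) ^ 2 := by rw [Finset.sum_const, nsmul_eq_mul, mul_assoc]
    _ ≤ 2 * ∑ p ∈ Uᶜ, 2 * A.cost ν (B * k) fun i => onPath p (level i) := by
      refine mul_le_mul' le_rfl (Finset.sum_le_sum fun p hp => ?_)
      exact A.le_cost_of_not_anticipates ν hmono hq hk hB (by simpa [U] using hp)
    _ = 4 * ∑ p ∈ Uᶜ, A.cost ν (B * k) fun i => onPath p (level i) := by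
      rw [← Finset.mul_sum, ← mul_assoc]; norm_num
    _ ≤ _ := by
      gcongr
      exact Finset.subset_univ _

end OnlineAlgorithm

/-! ### The offline bound and the choice of parameters. -/

open TreeVertex in
theorem offlineOpt_onPath_le {n k N : ℕ} (ν : MonotoneNorm n) {level : Fin n → Fin (k + 1)}
    (hk : 2 ≤ k) {B : ℝ≥0}
    (hB : ∀ j, ν ({i | level i = j}.indicator 1) ≤ 2 * B * k ^ (j : ℕ)) (p : Fin k → Fin N) :
    offlineOpt ν (B * k) (fun i => onPath p (level i)) ≤ 7 * (B * k) := by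
  refine (offlineOpt_le_singleton ν _ _ (onPath p (Fin.last k))).trans ?_
  have hk0 : (k : ℝ≥0) ≠ 0 := by exact_mod_cast (by omega : k ≠ 0)
  -- Splitting by depth, a block of norm at most `2 * B * k ^ j` at distance at most `2 * k ^ (-j)`
  -- from the leaf contributes at most `4 * B`.
  have h1 : (fun i => nndist (onPath p (level i)) (onPath p (Fin.last k))) ≤
      ∑ j : Fin (k + 1), (2 * ((k : ℝ≥0)⁻¹) ^ (j : ℕ)) • ({i | level i = j}.indicator (1 : Fin n → ℝ≥0)) := by
    intro i
    refine (nndist_onPath_last_le hk p (level i)).trans ?_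
    rw [Finset.sum_apply]
    refine le_trans ?_ (Finset.single_le_sum (fun _ _ => zero_le) (Finset.mem_univ (level i)))
    simp
  have h2 : ν (fun i => nndist (onPath p (level i)) (onPath p (Fin.last k))) ≤
      ∑ _j : Fin (k + 1), 4 * B := by
    refine (ν.mono _ _ h1).trans ((ν.sum_le _ _).trans (Finset.sum_le_sum fun j _ => ?_))
    rw [ν.smul_eq]
    calc _ ≤ 2 * ((k : ℝ≥0)⁻¹) ^ (j : ℕ) * (2 * B * k ^ (j : ℕ)) := by gcongr; exact hB j
      _ = 4 * B := by rw [inv_pow]; field_simp; ring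
  rw [Finset.sum_const, Finset.card_univ, Fintype.card_fin, nsmul_eq_mul] at h2
  have h3 : (2 : ℝ≥0) ≤ k := by exact_mod_cast hk
  have h4 := mul_le_mul_right h3 B
  -- The total is `B * k + 4 * B * (k + 1)`, and `4 * B ≤ 2 * B * k` because `k ≥ 2`.
  refine (add_le_add le_rfl h2).trans ?_
  rw [← NNReal.coe_le_coe] at *
  push_cast at *
  nlinarith

theorem hasTreeLowerBound_of_pow_le {n : ℕ} (ν : MonotoneNorm n) {m : ℝ≥0} {q : ℕ} (hq : 0 < q)
    (hm0 : 0 < m) (hm : ∀ i, ν (Pi.single i 1) ≤ m)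
    (htot : 4 * ((2 * q : ℕ) : ℝ≥0) ^ (2 * q) * m ≤ ν 1) {L : ℝ} (hL : 28 * L ≤ (2 * q : ℕ)) :
    HasTreeLowerBound.{w} ν L := by
  obtain ⟨k, hkq⟩ : ∃ k, k = 2 * q := ⟨_, rfl⟩
  have hk : 2 ≤ k := by omega
  have hk0 : (0 : ℝ≥0) < k := by exact_mod_cast (by omega : 0 < k)
  set B : ℝ≥0 := ν 1 / k ^ (2 * q) with hBdef
  have hBm : 4 * m ≤ B := by
    rw [hBdef, le_div_iff₀ (by positivity)]
    refine le_trans (le_of_eq ?_) htot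
    rw [← hkq]; ring
  have hB0 : 0 < B := lt_of_lt_of_le (by positivity) hBm
  have hBtot : ν 1 = B * k ^ (2 * q) := by
    rw [hBdef, div_mul_cancel₀ _ (by positivity)]
  have hlev := ν.exists_level hk hm hBm hB0 hBtot
  rw [← hkq] at hlev hL
  obtain ⟨level, hmono, hsurj, hup, hlow⟩ := hlev
  have hn : 0 < n := (hsurj 0).choose.pos
  refine hasTreeLowerBound_of_forall_deterministic (N := 2 * (q * n)) (f := B * k) level hk ?_
    (by positivity) hmono hsurj fun A => ?_
  · have := Nat.mul_pos hq hn; omega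
  · have h1 := A.le_sum_cost ν hmono hkq (by omega) le_rfl hlow
    have h2 : ∑ p : Fin k → Fin (2 * (q * n)),
        offlineOpt ν (B * k) (fun i => TreeVertex.onPath p (level i)) ≤
        ((2 * (q * n) : ℕ) : ℝ≥0) ^ k * (7 * (B * k)) := by
      refine (Finset.sum_le_sum fun p _ => offlineOpt_onPath_le ν hk hup p).trans (le_of_eq ?_)
      simp
    have h3 : 28 * L.toNNReal ≤ k := by
      rcases le_total L 0 with h | h
      · rw [Real.toNNReal_of_nonpos h, mul_zero]; exact zero_le
      · rw [← NNReal.coe_le_coe]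
        push_cast
        rwa [Real.coe_toNNReal L h]
    refine le_of_mul_le_mul_left ?_ (show (0 : ℝ≥0) < 4 by norm_num)
    refine le_trans ?_ h1
    -- The constant 28 is the factor 4 of `le_sum_cost` times the factor 7 of the offline bound.
    calc 4 * (L.toNNReal * _) ≤ 4 * (L.toNNReal * (((2 * (q * n) : ℕ) : ℝ≥0) ^ k * (7 * (B * k)))) := by
          gcongr
      _ = ((2 * (q * n) : ℕ) : ℝ≥0) ^ k * (B * ((28 * L.toNNReal) * k)) := by ring
      _ ≤ ((2 * (q * n) : ℕ) : ℝ≥0) ^ k * (B * (k * k)) := by gcongr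
      _ = _ := by rw [sq]

/-- For a ratio of at most 1 any instance will do, since no algorithm beats the optimum. Three
requests are needed to cover the depths 0, 1, 2. -/
theorem hasTreeLowerBound_of_le_one {n : ℕ} (ν : MonotoneNorm n) (hn : 3 ≤ n) {L : ℝ}
    (hL : L ≤ 1) : HasTreeLowerBound.{w} ν L := by
  refine hasTreeLowerBound_of_forall_deterministic (k := 2) (N := 2) (f := 1)
    (fun i => ⟨min i 2, by omega⟩) le_rfl le_rfl one_pos ?_ ?_ fun A => ?_
  · intro i j hij
    exact Fin.mk_le_mk.2 (min_le_min_right _ hij)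
  · intro j
    have := j.2
    exact ⟨⟨j, by omega⟩, Fin.ext (by simp; omega)⟩
  · refine (mul_le_of_le_one_left' (Real.toNNReal_le_one.2 hL)).trans ?_
    exact Finset.sum_le_sum fun p _ => offlineOpt_le_cost ν 1 (by omega) A _

/-! ### The bound in terms of σ and ρ. -/

namespace MonotoneNorm

theorem single_le_iSup {n : ℕ} (ν : MonotoneNorm n) (i : Fin n) :
    ν (Pi.single i 1) ≤ ⨆ i, ν (Pi.single i 1) :=
  le_ciSup (f := fun i => ν (Pi.single i 1)) (Set.finite_range _).bddAbove i

theorem sigma_le {n : ℕ} (ν : MonotoneNorm n) : ν.sigma ≤ n := by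
  refine div_le_of_le_mul₀ zero_le zero_le ?_
  have h : (1 : Fin n → ℝ≥0) = ∑ i, Pi.single i 1 := by
    simpa using (Finset.univ_sum_single (1 : Fin n → ℝ≥0)).symm
  conv_lhs => rw [h]
  refine (ν.sum_le _ _).trans ((Finset.sum_le_sum fun i _ => ν.single_le_iSup i).trans ?_)
  simp

theorem sigma_eq_rho {n : ℕ} {ν : MonotoneNorm n} (h : ν.IsSymmetric) : ν.sigma = ν.rho := by
  unfold sigma rho
  rcases isEmpty_or_nonempty (Fin n) with he | ⟨⟨i₀⟩⟩
  · rw [Subsingleton.elim (1 : Fin n → ℝ≥0) 0, map_zero, zero_div, zero_div]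
  · have hc : ∀ i, ν (Pi.single i 1) = ν (Pi.single i₀ 1) := fun i => by
      rw [← h (Equiv.swap i i₀) (Pi.single i 1)]
      congr 1
      funext j
      simp only [Function.comp, Pi.single_apply, Equiv.swap_apply_eq_iff, Equiv.swap_apply_left]
    have : Nonempty (Fin n) := ⟨i₀⟩
    simp only [hc, ciSup_const, ciInf_const]

theorem hasTreeLowerBound_log_sigma {n : ℕ} (ν : MonotoneNorm n) (hσ : 4 ≤ ν.sigma) :
    HasTreeLowerBound.{w} ν (1 / 224 * (Real.log ν.sigma / Real.log (Real.log ν.sigma))) := by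
  set x := Real.log ν.sigma with hx
  set y := Real.log x with hy
  have hσ' : (4 : ℝ) ≤ ν.sigma := by exact_mod_cast hσ
  -- The trivial instance handles small σ; afterwards `x / y > 224` makes `x` large and `q`
  -- positive.
  rcases le_or_gt (1 / 224 * (x / y)) 1 with hL | hL
  · refine hasTreeLowerBound_of_le_one ν ?_ hL
    have : (4 : ℝ≥0) ≤ n := hσ.trans ν.sigma_le
    have : 4 ≤ n := by exact_mod_cast this
    omega
  · have hx1 : 1.38 ≤ x := by
      have h1 : Real.log 4 ≤ x := Real.log_le_log (by norm_num) hσ'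
      have h2 : Real.log 4 = 2 * Real.log 2 := by
        rw [show (4 : ℝ) = 2 ^ 2 by norm_num, Real.log_pow]; norm_num
      have := Real.log_two_gt_d9
      linarith
    have hx0 : 0 < x := by linarith
    have hy1 : 1 / 4 ≤ y := by
      have h1 := Real.one_sub_inv_le_log_of_pos hx0
      have h2 : x⁻¹ ≤ (1.38 : ℝ)⁻¹ := inv_anti₀ (by norm_num) hx1
      have h3 : (1.38 : ℝ)⁻¹ ≤ 3 / 4 := by norm_num
      linarith
    have hy0 : 0 < y := by linarith
    have hxy : 224 < x / y := by linarith
    have hx56 : 56 ≤ x := by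
      have := (lt_div_iff₀ hy0).1 hxy
      linarith
    -- Since `2 * q ≤ x`, this makes `(2 * q) ^ (2 * q)` at most `exp (2 * q * y) ≤ exp (x / 4)`, so
    -- the extra factor 4 still fits below σ = `exp x`. As `224 = 28 * 8`, the bound on the ratio
    -- becomes `x / y / 8 < q + 1 ≤ 2 * q`.
    set q := ⌊x / y / 8⌋₊ with hq
    have hq1 : (q : ℝ) ≤ x / y / 8 := Nat.floor_le (by positivity)
    have hq2 : x / y / 8 < q + 1 := Nat.lt_floor_add_one _
    have hq0 : 0 < q := Nat.floor_pos.2 (by linarith)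
    have hσ0 : ν.sigma ≠ 0 := fun h => by rw [h] at hσ; exact absurd hσ (by norm_num)
    set m : ℝ≥0 := ⨆ i, ν (Pi.single i 1) with hm
    have hm0 : m ≠ 0 := fun h => hσ0 (by unfold sigma; rw [← hm, h, div_zero])
    have htot : ν 1 = ν.sigma * m := by unfold sigma; rw [← hm, div_mul_cancel₀ _ hm0]
    refine hasTreeLowerBound_of_pow_le ν hq0 (pos_iff_ne_zero.2 hm0) ν.single_le_iSup ?_ ?_
    · rw [htot]
      gcongr
      rw [← NNReal.coe_le_coe]
      push_cast
      have hqy : 2 * (q : ℝ) * y ≤ x / 4 := by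
        have h1 : (q : ℝ) * y ≤ x / y / 8 * y := by gcongr
        have h2 : x / y / 8 * y = x / 8 := by field_simp
        linarith
      have hqx : 2 * (q : ℝ) ≤ x := by
        have h1 : x / y ≤ x * 4 := by
          rw [div_le_iff₀ hy0]
          nlinarith
        linarith
      have h1 : (2 * (q : ℝ)) ^ (2 * q) ≤ Real.exp (x / 4) := by
        calc (2 * (q : ℝ)) ^ (2 * q) ≤ x ^ (2 * q) := by gcongr
          _ = Real.exp (2 * (q : ℝ) * y) := by
            rw [← Real.exp_log hx0, ← hy, ← Real.exp_nat_mul]; push_cast; rfl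
          _ ≤ _ := Real.exp_le_exp.2 hqy
      have h2 : (4 : ℝ) ≤ Real.exp (x * 3 / 4) := by
        have := Real.add_one_le_exp (x * 3 / 4)
        linarith
      calc 4 * (2 * (q : ℝ)) ^ (2 * q) ≤ Real.exp (x * 3 / 4) * Real.exp (x / 4) := by gcongr
        _ = ν.sigma := by
          rw [← Real.exp_add, show x * 3 / 4 + x / 4 = x by ring, hx, Real.exp_log (by linarith)]
    · push_cast
      linarith

end MonotoneNorm

theorem mainTheorem7 :
    ∃ c : ℝ, 0 < c ∧
      (∀ (n : ℕ) (ν : MonotoneNorm n), 4 ≤ ν.sigma →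
        HasTreeLowerBound.{w} ν (c * (Real.log ν.sigma / Real.log (Real.log ν.sigma)))) ∧
      (∀ (n : ℕ) (ν : MonotoneNorm n), ν.IsSymmetric →
        ν.sigma = ν.rho ∧
        (4 ≤ ν.rho →
          HasTreeLowerBound.{w} ν (c * (Real.log ν.rho / Real.log (Real.log ν.rho))))) := by
  refine ⟨1 / 224, by norm_num, fun n ν h => ν.hasTreeLowerBound_log_sigma h, fun n ν hs => ?_⟩
  have hσρ := MonotoneNorm.sigma_eq_rho hs
  exact ⟨hσρ, fun h => hσρ ▸ ν.hasTreeLowerBound_log_sigma (hσρ ▸ h)⟩
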